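/- **Theorem (Garrigós–Speegle).** Let $\mu$ be Lebesgue measure on $\mathbb{R}$. An orthonormal (dyadic) wavelet is a function $w\in L^2(\mathbb{R})$ for which the functions $w_{j,k}(s)=2^{j/2}w(2^js-k)$, $j,k\in\mathbb{Z}$, form an orthonormal basis of $L^2(\mathbb{R})$. A Lebesgue measurable set $W\subseteq\mathbb{R}$ is a wavelet set if $\mu(W)^{-1/2}\chi_W=\widehat{w}$ almost everywhere for some orthonormal wavelet $w$, where $\widehat{\,\cdot\,}$ is the Fourier–Plancherel transform on $L^2(\mathbb{R})$, normalized by $\widehat f(x)=\frac{1}{\sqrt{2\pi}}\int_{\mathbb{R}}e^{-itx}f(t)\,d\mu(t)$ for $f\in L^1(\mathbb{R})\cap L^2(\mathbb{R})$. For wavelet sets $W_1,W_2$ put $$d(W_1,W_2)=\mu(W_1\nabla W_2)^{1/2}+\left(\int_{W_1\nabla W_2}\frac{1}{|x|}\,d\mu(x)\right)^{1/2},\qquad W_1\nabla W_2=(W_1\setminus W_2)\cup(W_2\setminus W_1).$$ Then $d$ is a (finite) metric on the class of wavelet sets, sets that differ by a null set being identified, and this class is complete in $d$: if $(W_n)$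 is a sequence of wavelet sets that is Cauchy with respect to $d$, then there is a wavelet set $W$ with $d(W_n,W)\to 0$. -/

import Mathlib

open MeasureTheory Filter Topology
open scoped ENNReal FourierTransform symmDiff

noncomputable section

namespace Wavelet

/-- The complex Hilbert space `L²(ℝ)` with respect to Lebesgue measure. -/
abbrev L2R : Type := Lp ℂ 2 (volume : Measure ℝ)

/-- `w ∈ L²(ℝ)` is an orthonormal (dyadic) wavelet: the functions
`w_{j,k}(s) = 2^{j/2} w(2^j s - k)`, `j, k ∈ ℤ`, form an orthonormal basis of `L²(ℝ)`. -/
def IsOrthonormalWavelet (w : L2R) : Prop :=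
  ∃ b : HilbertBasis (ℤ × ℤ) ℂ L2R, ∀ j k : ℤ,
    (b (j, k) : ℝ → ℂ) =ᵐ[volume]
      fun s => (((2 : ℝ) ^ ((j : ℝ) / 2) : ℝ) : ℂ) * w ((2 : ℝ) ^ j * s - (k : ℝ))

/-- The Fourier–Plancherel transform on `L²(ℝ)` in the normalization
`f̂(x) = (2π)^{-1/2} ∫ e^{-itx} f(t) dt`. Mathlib's `L²` transform `𝓕` extends
`ξ ↦ ∫ e^{-2πitξ} f(t) dt`, so that `f̂(x) = (2π)^{-1/2} (𝓕 f)(x / 2π)`. -/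
def fourierPlancherel (f : L2R) : ℝ → ℂ :=
  fun x => ((1 / √(2 * Real.pi) : ℝ) : ℂ) * (𝓕 f : L2R) (x / (2 * Real.pi))

/-- A Lebesgue measurable set `W ⊆ ℝ` is a wavelet set if `μ(W)^{-1/2} χ_W` is the
Fourier–Plancherel transform of an orthonormal wavelet. (If `μ(W)` is `0` or `∞`, the right-hand
side below is zero almost everywhere, hence not the transform of a wavelet.) -/
def IsWaveletSet (W : Set ℝ) : Prop :=
  NullMeasurableSet W volume ∧ ∃ w : L2R, IsOrthonormalWavelet w ∧
    fourierPlancherel w =ᵐ[volume]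
      W.indicator fun _ => ((1 / √(volume.real W) : ℝ) : ℂ)

/-- `d(W₁, W₂) = μ(W₁ ∆ W₂)^{1/2} + (∫_{W₁ ∆ W₂} |x|⁻¹ dμ(x))^{1/2}`, a priori in `[0, ∞]`. -/
def waveletDist (W₁ W₂ : Set ℝ) : ℝ≥0∞ :=
  volume (W₁ ∆ W₂) ^ (1 / 2 : ℝ) +
    (∫⁻ x in W₁ ∆ W₂, ENNReal.ofReal (1 / |x|)) ^ (1 / 2 : ℝ)

end Wavelet

end

noncomputable section

namespace Wavelet

/-! ### Weighted affine substitutions as isometries of L² -/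

section WeightedComp

/-! On the Fourier side `w_{j,k}` becomes `x ↦ 2^{-j/2} e^{-ik 2^{-j} x} ŵ(2^{-j} x)`. When `ŵ = c
χ_W`, being an orthonormal basis turns into the geometric conditions `IsTile`: the dyadic dilates of
`W` are disjoint and cover the line, the `2π`-translates are disjoint, and the exponentials
`e^{iky}` are orthogonal on `W`. Orthogonality of the exponentials takes the place of the usual
covering by translates, because it passes directly to limits. The equivalence is
`IsTile.isWaveletSet` and `IsWaveletSet.isTile`; completeness of the exponentials on a
translation-disjoint set comes from `ae_restrict_eq_zero_of_forall_integral_exp`.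

The weight `dx/|x|` is invariant under dilations, so a set with disjoint dilates weighs at most as
much as the annulus `1 ≤ |x| < 2`; hence `d` is finite. The metric axioms come from those of `μ(A ∆
B)` and the subadditivity of the square root.

For completeness, a `d`-Cauchy sequence is Cauchy in the measure algebra of `dx + dx/|x|`, which is
complete, so there is a limit set `V`. Disjointness and orthogonality survive because they are
controlled by Lebesgue measure. Covering is controlled by `dx/|x|`: `dil_cover_of_tendsto_symmDiff`
unfolds the uncovered part of the annulus into the part of `W_n` outside `V`. Covering also keeps
`V` from being null. -/

theorem map_affine_volume {a : ℝ} (ha : a ≠ 0) (b : ℝ) :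
    Measure.map (fun x : ℝ => a * x - b) volume = ENNReal.ofReal |a⁻¹| • volume := by
  have h1 : (fun x : ℝ => a * x - b) = (fun y : ℝ => y - b) ∘ (fun x : ℝ => a * x) := rfl
  rw [h1, ← Measure.map_map (by fun_prop) (by fun_prop), Real.map_volume_mul_left ha,
    Measure.map_smul, (measurePreserving_sub_right volume b).map_eq]

theorem quasiMeasurePreserving_affine {a : ℝ} (ha : a ≠ 0) (b : ℝ) :
    Measure.QuasiMeasurePreserving (fun x : ℝ => a * x - b) volume volume := by
  refine ⟨by fun_prop, ?_⟩
  rw [map_affine_volume ha]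
  exact Measure.smul_absolutelyContinuous

theorem ae_mul_left {a : ℝ} (ha : a ≠ 0) {p : ℝ → Prop} (hp : ∀ᵐ x, p x) : ∀ᵐ x, p (a * x) := by
  simpa using (quasiMeasurePreserving_affine ha 0).ae hp

/-- `x ↦ φ x * f (a * x - b)` has the same `L²` norm as `f` when `|φ|² = |a|`. -/
theorem eLpNorm_weightedComp {φ : ℝ → ℂ} {a : ℝ} (ha : a ≠ 0) (b : ℝ)
    (hn : ∀ x, ‖φ x‖ = √|a|) {f : ℝ → ℂ} (hf : AEStronglyMeasurable f volume) :
    eLpNorm (fun x => φ x * f (a * x - b)) 2 volume = eLpNorm f 2 volume := by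
  have h1 : eLpNorm (fun x => φ x * f (a * x - b)) 2 volume
      = eLpNorm ((√|a| : ℝ) • (f ∘ fun x => a * x - b)) 2 volume := by
    refine eLpNorm_congr_norm_ae (.of_forall fun x => ?_)
    simp [hn, abs_of_nonneg (Real.sqrt_nonneg _)]
  have ha' : 0 < |a| := abs_pos.2 ha
  rw [h1, eLpNorm_const_smul, ← eLpNorm_map_measure, map_affine_volume ha,
    eLpNorm_smul_measure_of_ne_top (by simp)]
  · have h2 : ENNReal.ofReal |a⁻¹| ^ (1 / (2 : ℝ≥0∞)).toReal = ENNReal.ofReal (√|a|)⁻¹ := by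
      rw [ENNReal.ofReal_rpow_of_pos (by rw [abs_inv]; positivity)]
      congr 1
      rw [abs_inv, Real.sqrt_eq_rpow, Real.inv_rpow (abs_nonneg _)]
      simp
    rw [h2, smul_eq_mul, ← mul_assoc, Real.enorm_of_nonneg (Real.sqrt_nonneg _),
      ← ENNReal.ofReal_mul (Real.sqrt_nonneg _), mul_inv_cancel₀ (by positivity)]
    simp
  · rw [map_affine_volume ha]; exact hf.smul_measure _
  · fun_prop

theorem memLp_weightedComp {φ : ℝ → ℂ} {a : ℝ} (hφ : Continuous φ) (ha : a ≠ 0) (b : ℝ)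
    (hn : ∀ x, ‖φ x‖ = √|a|) {f : ℝ → ℂ} (hf : MemLp f 2 volume) :
    MemLp (fun x => φ x * f (a * x - b)) 2 volume := by
  refine ⟨hφ.aestronglyMeasurable.mul
    (hf.1.comp_quasiMeasurePreserving (quasiMeasurePreserving_affine ha b)), ?_⟩
  rw [eLpNorm_weightedComp ha b hn hf.1]
  exact hf.2

/-- The isometry `f ↦ (x ↦ φ x * f (a * x - b))` of `L²(ℝ)`, where `|φ|² = |a|`. -/
def weightedComp (φ : ℝ → ℂ) (a b : ℝ) (hφ : Continuous φ) (ha : a ≠ 0)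
    (hn : ∀ x, ‖φ x‖ = √|a|) : L2R →ₗᵢ[ℂ] L2R where
  toFun f := (memLp_weightedComp hφ ha b hn (Lp.memLp f)).toLp _
  map_add' f g := by
    rw [← MemLp.toLp_add, MemLp.toLp_eq_toLp_iff]
    filter_upwards [(quasiMeasurePreserving_affine ha b).ae (Lp.coeFn_add f g)] with x hx
    rw [Pi.add_apply] at hx
    change φ x * (f + g : L2R) (a * x - b) = φ x * f (a * x - b) + φ x * g (a * x - b)
    rw [hx, mul_add]
  map_smul' c f := by
    rw [RingHom.id_apply, ← MemLp.toLp_const_smul, MemLp.toLp_eq_toLp_iff]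
    filter_upwards [(quasiMeasurePreserving_affine ha b).ae (Lp.coeFn_smul c f)] with x hx
    rw [Pi.smul_apply, smul_eq_mul] at hx
    change φ x * (c • f : L2R) (a * x - b) = c * (φ x * f (a * x - b))
    rw [hx, mul_left_comm]
  norm_map' f := by
    simp only [LinearMap.coe_mk, AddHom.coe_mk]
    rw [Lp.norm_toLp, eLpNorm_weightedComp ha b hn (Lp.memLp f).1, Lp.norm_def]

variable {φ : ℝ → ℂ} {a b : ℝ} (hφ : Continuous φ) (ha : a ≠ 0) (hn : ∀ x, ‖φ x‖ = √|a|)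

theorem coeFn_weightedComp (f : L2R) :
    weightedComp φ a b hφ ha hn f =ᵐ[volume] fun x => φ x * f (a * x - b) :=
  MemLp.coeFn_toLp (memLp_weightedComp hφ ha b hn (Lp.memLp f))

theorem weightedComp_surjective : Function.Surjective (weightedComp φ a b hφ ha hn) := by
  intro g
  have h0 : ∀ x, φ x ≠ 0 := fun x hx => by
    have := hn x
    rw [hx, norm_zero] at this
    exact (Real.sqrt_pos.2 (abs_pos.2 ha)).ne this
  -- The inverse operator substitutes `y ↦ (y + b)/a` and divides by the weight at that point.
  let ψ : ℝ → ℂ := fun y => (φ (a⁻¹ * y - (-(b / a))))⁻¹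
  have hψ : Continuous ψ := Continuous.inv₀ (by fun_prop) fun y => h0 _
  have hψn : ∀ y, ‖ψ y‖ = √|a⁻¹| := fun y => by simp [ψ, hn, abs_inv]
  refine ⟨weightedComp ψ a⁻¹ (-(b / a)) hψ (inv_ne_zero ha) hψn g, Lp.ext ?_⟩
  filter_upwards [coeFn_weightedComp (b := b) hφ ha hn
      (weightedComp ψ a⁻¹ (-(b / a)) hψ (inv_ne_zero ha) hψn g),
    (quasiMeasurePreserving_affine ha b).ae
      (coeFn_weightedComp (b := -(b / a)) hψ (inv_ne_zero ha) hψn g)] with x h1 h2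
  have h3 : a⁻¹ * (a * x - b) - -(b / a) = x := by field_simp; ring
  rw [h1, h2]
  simp only [ψ, h3]
  rw [← mul_assoc, mul_inv_cancel₀ (h0 x), one_mul]

end WeightedComp

/-! ### The wavelet family under the Fourier–Plancherel transform -/

theorem norm_inv_sqrt_two_pi :
    ‖((1 / √(2 * Real.pi) : ℝ) : ℂ)‖ = √|(2 * Real.pi)⁻¹| := by
  rw [Complex.norm_real, Real.norm_of_nonneg (by positivity), abs_of_nonneg (by positivity),
    Real.sqrt_inv, one_div]

/-- The Fourier–Plancherel transform as a linear isometry. -/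
def plancherelIsometry : L2R →ₗᵢ[ℂ] L2R :=
  (weightedComp (fun _ => ((1 / √(2 * Real.pi) : ℝ) : ℂ)) (2 * Real.pi)⁻¹ 0 continuous_const
    (by positivity) (fun _ => norm_inv_sqrt_two_pi)).comp (Lp.fourierTransformₗᵢ ℝ ℂ).toLinearIsometry

theorem coeFn_plancherelIsometry (f : L2R) :
    plancherelIsometry f =ᵐ[volume] fourierPlancherel f := by
  refine (coeFn_weightedComp continuous_const (by positivity)
    (fun _ => norm_inv_sqrt_two_pi) (Lp.fourierTransformₗᵢ ℝ ℂ f)).trans (.of_forall fun x => ?_)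
  simp only [fourierPlancherel, sub_zero, div_eq_inv_mul]
  rfl

theorem plancherelIsometry_surjective : Function.Surjective plancherelIsometry :=
  (weightedComp_surjective continuous_const (by positivity)
    (fun _ => norm_inv_sqrt_two_pi)).comp (Lp.fourierTransformₗᵢ ℝ ℂ).surjective

theorem norm_two_rpow_half (j : ℤ) :
    ‖(((2 : ℝ) ^ ((j : ℝ) / 2) : ℝ) : ℂ)‖ = √|(2 : ℝ) ^ j| := by
  rw [Complex.norm_real, Real.norm_of_nonneg (by positivity), abs_of_nonneg (by positivity),
    Real.sqrt_eq_rpow, ← Real.rpow_intCast, ← Real.rpow_mul (by norm_num)]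
  congr 1; ring

/-- The isometry `w ↦ w_{j,k}`. -/
def dilTrans (j k : ℤ) : L2R →ₗᵢ[ℂ] L2R :=
  weightedComp (fun _ => (((2 : ℝ) ^ ((j : ℝ) / 2) : ℝ) : ℂ)) ((2 : ℝ) ^ j) k continuous_const
    (by positivity) (fun _ => norm_two_rpow_half j)

theorem coeFn_dilTrans (j k : ℤ) (w : L2R) : dilTrans j k w =ᵐ[volume]
    fun s => (((2 : ℝ) ^ ((j : ℝ) / 2) : ℝ) : ℂ) * w ((2 : ℝ) ^ j * s - (k : ℝ)) :=
  coeFn_weightedComp continuous_const (by positivity) (fun _ => norm_two_rpow_half j) w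

theorem norm_modDil_weight (j k : ℤ) (x : ℝ) :
    ‖(((2 : ℝ) ^ (((-j : ℤ) : ℝ) / 2) : ℝ) : ℂ) *
      Complex.exp (((-(k * ((2 : ℝ) ^ (-j) * x)) : ℝ) : ℂ) * Complex.I)‖ = √|(2 : ℝ) ^ (-j)| := by
  rw [norm_mul, Complex.norm_exp_ofReal_mul_I, mul_one, norm_two_rpow_half]

/-- The isometry that `w ↦ w_{j,k}` becomes on the Fourier side. -/
def modDil (j k : ℤ) : L2R →ₗᵢ[ℂ] L2R :=
  weightedComp (fun x => (((2 : ℝ) ^ (((-j : ℤ) : ℝ) / 2) : ℝ) : ℂ) *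
      Complex.exp (((-(k * ((2 : ℝ) ^ (-j) * x)) : ℝ) : ℂ) * Complex.I)) ((2 : ℝ) ^ (-j)) 0
    (by fun_prop) (by positivity)
    (norm_modDil_weight j k)

theorem coeFn_modDil (j k : ℤ) (h : L2R) : modDil j k h =ᵐ[volume]
    fun x => (((2 : ℝ) ^ (((-j : ℤ) : ℝ) / 2) : ℝ) : ℂ) *
      Complex.exp (((-(k * ((2 : ℝ) ^ (-j) * x)) : ℝ) : ℂ) * Complex.I) *
        h ((2 : ℝ) ^ (-j) * x) := by
  simpa only [sub_zero, modDil] using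
    coeFn_weightedComp (b := 0) (by fun_prop) (by positivity) (norm_modDil_weight j k) h

theorem fourier_affine (f : ℝ → ℂ) {a : ℝ} (ha : 0 < a) (b : ℝ) (ξ : ℝ) :
    𝓕 (fun s => f (a * s - b)) ξ =
      ((a⁻¹ : ℝ) : ℂ) * Complex.exp (((-(2 * Real.pi * (b * (a⁻¹ * ξ))) : ℝ) : ℂ) * Complex.I) *
        𝓕 f (a⁻¹ * ξ) := by
  rw [Real.fourier_real_eq_integral_exp_smul, Real.fourier_real_eq_integral_exp_smul]
  let G : ℝ → ℂ := fun t => Complex.exp (↑(-2 * Real.pi * (t + b) * (a⁻¹ * ξ)) * Complex.I) • f t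
  have h1 : ∀ s : ℝ, Complex.exp (↑(-2 * Real.pi * s * ξ) * Complex.I) • f (a * s - b)
      = (fun u => G (u - b)) (a * s) := by
    intro s
    simp only [G]
    congr 4
    field_simp; ring
  rw [integral_congr_ae (.of_forall h1), Measure.integral_comp_mul_left (fun u => G (u - b)), integral_sub_right_eq_self (fun u => G u) b,
    abs_of_pos (inv_pos.2 ha), Complex.real_smul, mul_assoc]
  congr 1
  rw [← integral_const_mul]
  refine integral_congr_ae (.of_forall fun t => ?_)
  simp only [G, smul_eq_mul, ← mul_assoc, ← Complex.exp_add]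
  congr 2
  push_cast; ring

/-- The Schwartz function `s ↦ f (a * s - b)`. -/
theorem exists_schwartz_affine (f : SchwartzMap ℝ ℂ) {a : ℝ} (ha : a ≠ 0) (b : ℝ) :
    ∃ g : SchwartzMap ℝ ℂ, ∀ s, g s = f (a * s - b) :=
  ⟨SchwartzMap.compCLMOfContinuousLinearEquiv ℝ
    (ContinuousLinearEquiv.unitsEquivAut ℝ (Units.mk0 a ha)) (f.compSubConstCLM ℝ b), fun s => by
      simp [mul_comm]⟩

/-- Both sides are continuous in `w`, so it suffices to treat Schwartz functions, where the
transform is an integral and `fourier_affine` applies. -/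
theorem plancherelIsometry_dilTrans (j k : ℤ) (w : L2R) :
    plancherelIsometry (dilTrans j k w) = modDil j k (plancherelIsometry w) := by
  refine DenseRange.induction_on (e := SchwartzMap.toLpCLM ℝ (E := ℝ) ℂ 2 volume)
    (p := fun w => plancherelIsometry (dilTrans j k w) = modDil j k (plancherelIsometry w))
    (SchwartzMap.denseRange_toLpCLM ENNReal.ofNat_ne_top) w ?_ ?_
  · exact isClosed_eq (by fun_prop) (by fun_prop)
  intro f
  obtain ⟨g, hg⟩ := exists_schwartz_affine f (a := (2 : ℝ) ^ j) (by positivity) k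
  set c : ℂ := (((2 : ℝ) ^ ((j : ℝ) / 2) : ℝ) : ℂ) with hc
  have h1 : dilTrans j k (f.toLp 2 volume) = c • g.toLp 2 volume := by
    refine Lp.ext ?_
    filter_upwards [coeFn_dilTrans j k (f.toLp 2 volume), Lp.coeFn_smul c (g.toLp 2 volume),
      g.coeFn_toLp 2 volume, (quasiMeasurePreserving_affine (a := (2 : ℝ) ^ j) (by positivity) k).ae
        (f.coeFn_toLp 2 volume)] with x h1 h2 h3 h4
    rw [h1, h2, h4, Pi.smul_apply, h3, hg, smul_eq_mul]
  have key : ∀ f : SchwartzMap ℝ ℂ, ∀ᵐ x : ℝ, plancherelIsometry (f.toLp 2 volume) x =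
      ((1 / √(2 * Real.pi) : ℝ) : ℂ) * 𝓕 (f : ℝ → ℂ) (x / (2 * Real.pi)) := by
    intro f
    have h := (𝓕 f).coeFn_toLp 2 volume
    filter_upwards [coeFn_plancherelIsometry (f.toLp 2 volume),
      ae_mul_left (a := (2 * Real.pi)⁻¹) (by positivity) h] with x h1 h2
    rw [h1, fourierPlancherel, SchwartzMap.toLp_fourier_eq, div_eq_inv_mul x, h2,
      SchwartzMap.fourier_coe]
  rw [SchwartzMap.toLpCLM_apply, h1, map_smul]
  refine Lp.ext ?_
  filter_upwards [Lp.coeFn_smul c (plancherelIsometry (g.toLp 2 volume)), key g,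
    ae_mul_left (a := (2 : ℝ) ^ (-j)) (by positivity) (key f),
    coeFn_modDil j k (plancherelIsometry (f.toLp 2 volume))] with x h1 h2 h3 h4
  rw [h1, h4, h3, Pi.smul_apply, h2, smul_eq_mul]
  have h5 : (g : ℝ → ℂ) = fun s => f ((2 : ℝ) ^ j * s - k) := funext hg
  rw [h5, fourier_affine _ (by positivity)]
  -- The normalization `2^{j/2}` meets the Jacobian `2^{-j}` of the substitution.
  have h6 : c * ((((2 : ℝ) ^ j)⁻¹ : ℝ) : ℂ) = (((2 : ℝ) ^ (((-j : ℤ) : ℝ) / 2) : ℝ) : ℂ) := by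
    rw [hc, ← Complex.ofReal_mul, ← Real.rpow_intCast, ← Real.rpow_neg (by norm_num),
      ← Real.rpow_add (by norm_num)]
    congr 2
    push_cast; ring
  have h7 : ((2 : ℝ) ^ j)⁻¹ * (x / (2 * Real.pi)) = (2 : ℝ) ^ (-j) * x / (2 * Real.pi) := by
    rw [zpow_neg]; ring
  have h8 : 2 * Real.pi * ((k : ℝ) * ((2 : ℝ) ^ (-j) * x / (2 * Real.pi)))
      = k * ((2 : ℝ) ^ (-j) * x) := by
    field_simp
  rw [h7, h8, ← h6]
  ring

/-! ### Uniqueness for Fourier coefficients and completeness of exponentials -/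

section Uniqueness

variable {Ω : Type*} [MeasurableSpace Ω] {μ : Measure Ω} {T : ℝ} [hT : Fact (0 < T)]
  {q : Ω → AddCircle T} {g : Ω → ℂ}

/-- Trigonometric polynomials are uniformly dense, and the integral is a functional of `φ` bounded
by the `L¹` norm of `g`. -/
theorem integral_continuousMap_mul_eq_zero (hq : Measurable q) (hg : Integrable g μ)
    (h : ∀ k : ℤ, ∫ x, fourier k (q x) * g x ∂μ = 0) (φ : C(AddCircle T, ℂ)) :
    ∫ x, φ (q x) * g x ∂μ = 0 := by
  have hint : ∀ φ : C(AddCircle T, ℂ), Integrable (fun x => φ (q x) * g x) μ := fun φ =>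
    hg.bdd_mul (φ.continuous.measurable.comp hq).aestronglyMeasurable
      (.of_forall fun x => φ.norm_coe_le_norm (q x))
  let Λ : C(AddCircle T, ℂ) →L[ℂ] ℂ := LinearMap.mkContinuous
    { toFun := fun φ => ∫ x, φ (q x) * g x ∂μ
      map_add' := fun φ ψ => by
        rw [← integral_add (hint φ) (hint ψ)]; simp [add_mul]
      map_smul' := fun c φ => by
        rw [RingHom.id_apply, smul_eq_mul, ← integral_const_mul]; simp [mul_assoc] }
    (∫ x, ‖g x‖ ∂μ) fun φ => by
      rw [mul_comm, ← integral_const_mul]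
      refine norm_integral_le_of_norm_le (hg.norm.const_mul _) (.of_forall fun x => ?_)
      rw [norm_mul]
      gcongr
      exact φ.norm_coe_le_norm (q x)
  have hle : (Submodule.span ℂ (Set.range (@fourier T))).topologicalClosure ≤
      LinearMap.ker Λ.toLinearMap := by
    refine Submodule.topologicalClosure_minimal _ ?_ Λ.isClosed_ker
    rw [Submodule.span_le]
    rintro _ ⟨k, rfl⟩
    exact h k
  rw [span_fourier_closure_eq_top] at hle
  exact hle (Submodule.mem_top (x := φ))

/-- Indicators of closed sets are bounded limits of continuous functions; a π-λ argument gives all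
Borel sets. Since `q` need not be injective, only sets pulled back from the circle are reached. -/
theorem setIntegral_preimage_eq_zero (hq : Measurable q) (hg : Integrable g μ)
    (h : ∀ k : ℤ, ∫ x, fourier k (q x) * g x ∂μ = 0) {A : Set (AddCircle T)}
    (hA : MeasurableSet A) : ∫ x in q ⁻¹' A, g x ∂μ = 0 := by
  -- The frequency `0` gives the total integral, needed for complements.
  have huniv : ∫ x, g x ∂μ = 0 := by simpa using h 0
  refine MeasurableSpace.induction_on_inter (C := fun A _ => ∫ x in q ⁻¹' A, g x ∂μ = 0)
    ((BorelSpace.measurable_eq (α := AddCircle T)).trans borel_eq_generateFrom_isClosed)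
    isPiSystem_isClosed (by simp) ?_ ?_ ?_ A hA
  · intro F hF
    have hF : IsClosed F := hF
    have hlim : Tendsto (fun n => ∫ x, (((hF.apprSeq n (q x) : NNReal) : ℝ) : ℂ) * g x ∂μ) atTop
        (𝓝 (∫ x, (q ⁻¹' F).indicator g x ∂μ)) := by
      refine tendsto_integral_of_dominated_convergence (fun x => ‖g x‖) (fun n => ?_) hg.norm
        (fun n => .of_forall fun x => ?_) (.of_forall fun x => ?_)
      · refine AEStronglyMeasurable.mul (Measurable.aestronglyMeasurable ?_) hg.1
        have := (hF.apprSeq n).continuous.measurable.comp hq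
        exact Complex.measurable_ofReal.comp (measurable_coe_nnreal_real.comp this)
      · rw [norm_mul]
        refine mul_le_of_le_one_left (norm_nonneg _) ?_
        have := HasOuterApproxClosed.apprSeq_apply_le_one hF n (q x)
        simpa using this
      · have h1 := tendsto_pi_nhds.1 (HasOuterApproxClosed.tendsto_apprSeq hF) (q x)
        have h2 := (((Complex.continuous_ofReal.comp NNReal.continuous_coe).tendsto _).comp
          h1).mul_const (g x)
        have h3 : (Complex.ofReal ∘ NNReal.toReal) (F.indicator (fun _ => 1) (q x)) * g x =
            (q ⁻¹' F).indicator g x := by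
          by_cases hx : q x ∈ F <;> simp [hx]
        rw [← h3]
        exact h2
    rw [← integral_indicator (hq hF.measurableSet)]
    refine tendsto_nhds_unique hlim ?_
    refine tendsto_const_nhds.congr fun n => ?_
    exact (integral_continuousMap_mul_eq_zero hq hg h
      ⟨fun c => (((hF.apprSeq n c : NNReal) : ℝ) : ℂ), by fun_prop⟩).symm
  · intro A hA hzero
    have := integral_add_compl (hq hA) hg
    rwa [hzero, zero_add, huniv] at this
  · intro f hd hfm hzero
    rw [Set.preimage_iUnion]
    refine (hasSum_integral_iUnion (fun i => hq (hfm i)) (fun i j hij => (hd hij).preimage q)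
      hg.integrableOn).unique ?_
    simp [hzero]

end Uniqueness

instance : Fact (0 < 2 * Real.pi) := ⟨by positivity⟩

theorem fourier_two_pi (k : ℤ) (x : ℝ) :
    fourier k (x : AddCircle (2 * Real.pi)) = Complex.exp (((k * x : ℝ) : ℂ) * Complex.I) := by
  rw [fourier_coe_apply]
  congr 1
  push_cast
  field_simp

/-- Disjointness of the translates makes the projection of `W` to the circle injective off a null
set. Hence every measurable part of `W` agrees a.e. on `W` with a set pulled back from the circle,
and `g` integrates to zero over it. -/
theorem ae_restrict_eq_zero_of_forall_integral_exp {W : Set ℝ} (hW : MeasurableSet W)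
    (hd : ∀ k : ℤ, k ≠ 0 → ∀ᵐ x : ℝ, x ∈ W → x + k * (2 * Real.pi) ∉ W) {g : ℝ → ℂ}
    (hg : IntegrableOn g W)
    (h : ∀ k : ℤ, ∫ x in W, Complex.exp (((k * x : ℝ) : ℂ) * Complex.I) * g x = 0) :
    ∀ᵐ x, x ∈ W → g x = 0 := by
  rw [← ae_restrict_iff' hW]
  refine Integrable.ae_eq_zero_of_forall_setIntegral_eq_zero hg fun B hB _ => ?_
  -- The `2π`-periodization of `B ∩ W`; within `W` it adds only a null set.
  let S : Set ℝ := ⋃ k : ℤ, (fun x : ℝ => x + k * (2 * Real.pi)) ⁻¹' (B ∩ W)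
  have hS : MeasurableSet S := .iUnion fun k =>
    (measurable_id.add_const _) (hB.inter hW)
  have hper : ∀ x y : ℝ, (x : AddCircle (2 * Real.pi)) = y → x ∈ S → y ∈ S := by
    intro x y hxy hx
    obtain ⟨k, hk⟩ := Set.mem_iUnion.1 hx
    have h0 : ((x - y : ℝ) : AddCircle (2 * Real.pi)) = 0 := by
      rw [AddCircle.coe_sub, hxy, sub_self]
    obtain ⟨n, hn⟩ := AddCircle.coe_eq_zero_iff _ |>.1 h0
    refine Set.mem_iUnion.2 ⟨n + k, ?_⟩
    have h1 : y + ((n + k : ℤ) : ℝ) * (2 * Real.pi) = x + k * (2 * Real.pi) := by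
      rw [zsmul_eq_mul] at hn
      push_cast
      linarith
    simpa only [Set.mem_preimage, h1] using hk
  -- The projection of `S`, tested on representatives in `(0, 2π]` so that its measurability is
  -- immediate.
  let A : Set (AddCircle (2 * Real.pi)) :=
    {c | ((AddCircle.measurableEquivIoc (2 * Real.pi) 0 c : Set.Ioc 0 (0 + 2 * Real.pi)) : ℝ) ∈ S}
  have hA : MeasurableSet A :=
    (measurable_subtype_coe.comp (AddCircle.measurableEquivIoc (2 * Real.pi) 0).measurable) hS
  have hAS : (fun x : ℝ => (x : AddCircle (2 * Real.pi))) ⁻¹' A = S := by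
    ext x
    have hx : (((AddCircle.measurableEquivIoc (2 * Real.pi) 0 (x : AddCircle (2 * Real.pi)) :
        Set.Ioc 0 (0 + 2 * Real.pi)) : ℝ) : AddCircle (2 * Real.pi)) = x :=
      AddCircle.coe_equivIoc ..
    exact ⟨hper _ _ hx, hper _ _ hx.symm⟩
  have hzero := setIntegral_preimage_eq_zero (T := 2 * Real.pi) (μ := volume.restrict W)
    (q := fun x : ℝ => (x : AddCircle (2 * Real.pi))) AddCircle.measurable_mk' hg
    (fun k => by simpa only [fourier_two_pi] using h k) hA
  rw [hAS] at hzero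
  rw [← hzero]
  refine setIntegral_congr_set ?_
  have hd' : ∀ᵐ x : ℝ, ∀ k : ℤ, k ≠ 0 → x ∈ W → x + k * (2 * Real.pi) ∉ W :=
    ae_all_iff.2 fun k => by
      by_cases hk : k = 0
      · simp [hk]
      · simpa [hk] using hd k hk
  filter_upwards [ae_restrict_of_ae hd', ae_restrict_mem hW] with x hx hxW
  refine propext ⟨fun hxB => Set.mem_iUnion.2 ⟨0, by simpa using ⟨hxB, hxW⟩⟩, fun hxS => ?_⟩
  obtain ⟨k, hk⟩ := Set.mem_iUnion.1 hxS
  by_cases hk0 : k = 0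
  · change x ∈ B
    simpa [hk0] using hk.1
  · exact absurd hk.2 (hx k hk0 hxW)

/-! ### The basis property on the Fourier side -/

/-- Being an orthonormal wavelet, read off on the Fourier side. -/
theorem isOrthonormalWavelet_iff (w : L2R) : IsOrthonormalWavelet w ↔
    Orthonormal ℂ (fun p : ℤ × ℤ => modDil p.1 p.2 (plancherelIsometry w)) ∧
      ∀ f : L2R, (∀ j k : ℤ, inner ℂ (modDil j k (plancherelIsometry w)) f = 0) → f = 0 := by
  have hcomp : (fun p : ℤ × ℤ => modDil p.1 p.2 (plancherelIsometry w)) =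
      plancherelIsometry ∘ fun p : ℤ × ℤ => dilTrans p.1 p.2 w :=
    funext fun p => (plancherelIsometry_dilTrans p.1 p.2 w).symm
  rw [hcomp, LinearIsometry.orthonormal_comp_iff]
  simp_rw [← plancherelIsometry_dilTrans]
  constructor
  · rintro ⟨b, hb⟩
    have hb' : (fun p : ℤ × ℤ => dilTrans p.1 p.2 w) = b :=
      funext fun p => Lp.ext ((coeFn_dilTrans p.1 p.2 w).trans (hb p.1 p.2).symm)
    refine ⟨hb' ▸ b.orthonormal, fun f hf => ?_⟩
    obtain ⟨g, rfl⟩ := plancherelIsometry_surjective f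
    simp_rw [LinearIsometry.inner_map_map] at hf
    have : g = 0 := by
      have h1 : b.repr g = 0 := by
        ext p
        rw [b.repr_apply_apply, ← hb']
        exact hf p.1 p.2
      simpa using h1
    rw [this, map_zero]
  · rintro ⟨ho, hc⟩
    refine ⟨HilbertBasis.mkOfOrthogonalEqBot ho ?_, fun j k => ?_⟩
    · rw [Submodule.eq_bot_iff]
      intro f hf
      apply (map_eq_zero_iff plancherelIsometry plancherelIsometry.injective).1
      refine hc _ fun j k => ?_
      rw [LinearIsometry.inner_map_map]
      exact hf _ (Submodule.subset_span ⟨(j, k), rfl⟩)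
    · rw [HilbertBasis.coe_mkOfOrthogonalEqBot]
      exact coeFn_dilTrans j k w

/-- The substitution `x = 2^j y` moves the dilation onto `f`, so that for every scale the same
exponentials `e^{iky}` are tested against `h`. -/
theorem inner_modDil (j k : ℤ) (h f : L2R) : inner ℂ (modDil j k h) f =
    (((2 : ℝ) ^ ((j : ℝ) / 2) : ℝ) : ℂ) * ∫ y : ℝ,
      Complex.exp (((k * y : ℝ) : ℂ) * Complex.I) * (starRingEnd ℂ (h y) * f ((2 : ℝ) ^ j * y)) := by
  let G : ℝ → ℂ := fun y =>
    Complex.exp (((k * y : ℝ) : ℂ) * Complex.I) * (starRingEnd ℂ (h y) * f ((2 : ℝ) ^ j * y))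
  rw [L2.inner_def]
  have h1 : (fun x => inner ℂ (modDil j k h x) (f x)) =ᵐ[volume]
      fun x => (((2 : ℝ) ^ (((-j : ℤ) : ℝ) / 2) : ℝ) : ℂ) * G ((2 : ℝ) ^ (-j) * x) := by
    filter_upwards [coeFn_modDil j k h] with x hx
    have h2 : (2 : ℝ) ^ j * ((2 : ℝ) ^ (-j) * x) = x := by
      rw [← mul_assoc, ← zpow_add₀ (by norm_num)]; simp
    simp only [RCLike.inner_apply, G, hx, h2, map_mul, Complex.conj_ofReal, ← Complex.exp_conj,
      Complex.conj_I, mul_neg]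
    rw [Complex.ofReal_neg, neg_mul, neg_neg]
    ring
  rw [integral_congr_ae h1, integral_const_mul, Measure.integral_comp_mul_left, Complex.real_smul,
    ← mul_assoc, ← Complex.ofReal_mul]
  congr 3
  rw [abs_of_nonneg (by positivity), ← zpow_neg, neg_neg, ← Real.rpow_intCast,
    ← Real.rpow_add (by norm_num)]
  congr 1
  push_cast; ring

/-! ### Wavelet sets are tiles up to null sets -/

section IndicatorFamily

variable {W : Set ℝ} {h : L2R} {c : ℝ}

theorem inner_modDil_of_indicator (hW : MeasurableSet W)
    (hh : h =ᵐ[volume] W.indicator fun _ => (c : ℂ)) (j k : ℤ) (f : L2R) :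
    inner ℂ (modDil j k h) f = (((2 : ℝ) ^ ((j : ℝ) / 2) : ℝ) : ℂ) * (c * ∫ y in W,
      Complex.exp (((k * y : ℝ) : ℂ) * Complex.I) * f ((2 : ℝ) ^ j * y)) := by
  rw [inner_modDil]
  congr 1
  rw [← integral_const_mul, ← integral_indicator hW]
  refine integral_congr_ae ?_
  filter_upwards [hh] with y hy
  rw [hy]
  by_cases hyW : y ∈ W <;> simp [hyW]
  ring

theorem inner_modDil_modDil_same (hW : MeasurableSet W)
    (hh : h =ᵐ[volume] W.indicator fun _ => (c : ℂ)) (j k l : ℤ) :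
    inner ℂ (modDil j k h) (modDil j l h) =
      c ^ 2 * ∫ y in W, Complex.exp ((((k - l : ℤ) * y : ℝ) : ℂ) * Complex.I) := by
  rw [inner_modDil_of_indicator hW hh]
  have h1 : ∀ᵐ y ∂(volume.restrict W), Complex.exp (((k * y : ℝ) : ℂ) * Complex.I) *
      modDil j l h ((2 : ℝ) ^ j * y) = ((((2 : ℝ) ^ (((-j : ℤ) : ℝ) / 2) : ℝ) : ℂ) * c) *
        Complex.exp ((((k - l : ℤ) * y : ℝ) : ℂ) * Complex.I) := by
    filter_upwards [ae_restrict_mem hW, ae_restrict_of_ae hh, ae_restrict_of_ae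
      (ae_mul_left (a := (2 : ℝ) ^ j) (by positivity) (coeFn_modDil j l h))] with y hyW hy h2
    have h3 : (2 : ℝ) ^ (-j) * ((2 : ℝ) ^ j * y) = y := by
      rw [← mul_assoc, ← zpow_add₀ (by norm_num)]; simp
    rw [h2, h3, hy, Set.indicator_of_mem hyW]
    have h4 : Complex.exp ((((k - l : ℤ) * y : ℝ) : ℂ) * Complex.I) =
        Complex.exp (((k * y : ℝ) : ℂ) * Complex.I) *
          Complex.exp (((-(l * y) : ℝ) : ℂ) * Complex.I) := by
      rw [← Complex.exp_add]; congr 1; push_cast; ring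
    rw [h4]; ring
  rw [integral_congr_ae h1, integral_const_mul]
  have h5 : (((2 : ℝ) ^ ((j : ℝ) / 2) : ℝ) : ℂ) * (((2 : ℝ) ^ (((-j : ℤ) : ℝ) / 2) : ℝ) : ℂ)
      = 1 := by
    rw [← Complex.ofReal_mul, ← Real.rpow_add (by norm_num)]
    push_cast
    rw [show (j : ℝ) / 2 + -(j : ℝ) / 2 = 0 by ring]
    simp
  linear_combination ((c : ℂ) ^ 2 *
    ∫ y in W, Complex.exp ((((k - l : ℤ) * y : ℝ) : ℂ) * Complex.I)) * h5

/-- The geometric description of wavelet sets: dyadic dilates and `2π`-translates of `W` are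
disjoint, the dilates cover the line, and the exponentials are orthogonal on `W`. -/
structure IsTile (W : Set ℝ) : Prop where
  measurableSet : MeasurableSet W
  volume_ne_zero : volume W ≠ 0
  volume_ne_top : volume W ≠ ∞
  dil_disjoint : ∀ j : ℤ, j ≠ 0 → ∀ᵐ x : ℝ, x ∈ W → (2 : ℝ) ^ j * x ∉ W
  dil_cover : ∀ᵐ x : ℝ, ∃ j : ℤ, (2 : ℝ) ^ j * x ∈ W
  trans_disjoint : ∀ k : ℤ, k ≠ 0 → ∀ᵐ x : ℝ, x ∈ W → x + k * (2 * Real.pi) ∉ W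
  exp_orthogonal : ∀ k : ℤ, k ≠ 0 →
    ∫ y in W, Complex.exp (((k * y : ℝ) : ℂ) * Complex.I) = 0

theorem one_div_sqrt_sq_mul (hW : volume W ≠ 0) (hW' : volume W ≠ ∞) :
    (((1 / √(volume.real W) : ℝ) : ℂ)) ^ 2 * (volume.real W : ℂ) = 1 := by
  have h0 : 0 < volume.real W := ENNReal.toReal_pos hW hW'
  rw [← Complex.ofReal_pow, ← Complex.ofReal_mul, div_pow, Real.sq_sqrt h0.le]
  field_simp
  simp

/-- Different scales have disjoint supports, and within a scale orthogonality is that of the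
exponentials on `W`. If `f` is orthogonal to the family, each rescaling of `f` vanishes a.e. on `W`
by completeness of the exponentials, and the dilates of `W` cover the line. -/
theorem IsTile.isWaveletSet (hW : IsTile W) : IsWaveletSet W := by
  refine ⟨hW.measurableSet.nullMeasurableSet, ?_⟩
  set c : ℝ := 1 / √(volume.real W) with hc
  let h : L2R := indicatorConstLp 2 hW.measurableSet hW.volume_ne_top (c : ℂ)
  have hh : h =ᵐ[volume] W.indicator fun _ => (c : ℂ) := indicatorConstLp_coeFn
  obtain ⟨w, hw⟩ := plancherelIsometry_surjective h
  refine ⟨w, ?_, ((coeFn_plancherelIsometry w).symm.trans (hw ▸ hh))⟩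
  have hc0 : c ≠ 0 := by
    have h0 : 0 < volume.real W := ENNReal.toReal_pos hW.volume_ne_zero hW.volume_ne_top
    positivity
  rw [isOrthonormalWavelet_iff, hw]
  constructor
  · classical
    rw [orthonormal_iff_ite]
    rintro ⟨j, k⟩ ⟨i, l⟩
    by_cases hij : j = i
    · subst hij
      simp only [inner_modDil_modDil_same hW.measurableSet hh]
      by_cases hkl : k = l
      · subst hkl
        have h1 := one_div_sqrt_sq_mul hW.volume_ne_zero hW.volume_ne_top
        rw [← hc] at h1
        simpa using h1
      · rw [hW.exp_orthogonal _ (sub_ne_zero.2 hkl)]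
        simp [hkl]
    · simp only [inner_modDil_of_indicator hW.measurableSet hh]
      rw [if_neg (by simp [hij]), integral_eq_zero_of_ae, mul_zero, mul_zero]
      filter_upwards [ae_restrict_mem hW.measurableSet,
        ae_restrict_of_ae (hW.dil_disjoint (j - i) (sub_ne_zero.2 hij)), ae_restrict_of_ae
        (ae_mul_left (a := (2 : ℝ) ^ j) (by positivity) (coeFn_modDil i l h)), ae_restrict_of_ae
        (ae_mul_left (a := (2 : ℝ) ^ (j - i)) (by positivity) hh)] with y h1 h2 h3 h4
      have h5 : (2 : ℝ) ^ (-i) * ((2 : ℝ) ^ j * y) = (2 : ℝ) ^ (j - i) * y := by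
        rw [← mul_assoc, ← zpow_add₀ (by norm_num)]; congr 2; ring
      rw [h3, h5, h4, Set.indicator_of_notMem (h2 h1)]
      simp
  · intro f hf
    have hzero : ∀ᵐ y : ℝ, ∀ j : ℤ, y ∈ W → f ((2 : ℝ) ^ j * y) = 0 := by
      refine ae_all_iff.2 fun j => ?_
      refine ae_restrict_eq_zero_of_forall_integral_exp hW.measurableSet hW.trans_disjoint ?_
        fun k => ?_
      · have : Fact (volume W < ∞) := ⟨hW.volume_ne_top.lt_top⟩
        have h1 : MemLp (fun y => f ((2 : ℝ) ^ j * y)) 2 volume := by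
          have := memLp_weightedComp (φ := fun _ => (((2 : ℝ) ^ ((j : ℝ) / 2) : ℝ) : ℂ))
            continuous_const (a := (2 : ℝ) ^ j) (by positivity) 0
            (fun _ => norm_two_rpow_half j) (Lp.memLp f)
          have := this.const_mul ((((2 : ℝ) ^ ((j : ℝ) / 2) : ℝ) : ℂ))⁻¹
          refine (memLp_congr_ae (.of_forall fun y => ?_)).1 this
          have h2 : ((((2 : ℝ) ^ ((j : ℝ) / 2) : ℝ) : ℂ)) ≠ 0 :=
            Complex.ofReal_ne_zero.2 (by positivity)
          simp only [sub_zero]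
          rw [← mul_assoc, inv_mul_cancel₀ h2, one_mul]
        exact h1.restrict W |>.integrable one_le_two
      · have h1 := hf j k
        rw [inner_modDil_of_indicator hW.measurableSet hh] at h1
        have h2 : ((((2 : ℝ) ^ ((j : ℝ) / 2) : ℝ) : ℂ)) ≠ 0 :=
          Complex.ofReal_ne_zero.2 (by positivity)
        simpa [h2, hc0] using h1
    have hzero' : ∀ᵐ x : ℝ, ∀ i : ℤ, ∀ j : ℤ,
        (2 : ℝ) ^ i * x ∈ W → f ((2 : ℝ) ^ j * ((2 : ℝ) ^ i * x)) = 0 :=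
      ae_all_iff.2 fun i => ae_mul_left (a := (2 : ℝ) ^ i) (by positivity) hzero
    refine Lp.ext ?_
    filter_upwards [hzero', hW.dil_cover, Lp.coeFn_zero ℂ 2 (volume : Measure ℝ)] with x h1 h2 h3
    obtain ⟨i, hi⟩ := h2
    have h4 := h1 i (-i) hi
    rw [← mul_assoc, ← zpow_add₀ (by norm_num)] at h4
    rw [h3]
    simpa using h4

theorem IsWaveletSet.congr {W V : Set ℝ} (hW : IsWaveletSet W) (h : W =ᵐ[volume] V) :
    IsWaveletSet V := by
  obtain ⟨hm, w, hw, hw'⟩ := hW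
  refine ⟨hm.congr h, w, hw, hw'.trans ?_⟩
  rw [measureReal_congr h]
  exact indicator_ae_eq_of_ae_eq_set h

/-- If the modulated dilates of `c χ_W` are complete, a square integrable function whose dilates
are orthogonal to all exponentials on `W` vanishes. -/
theorem ae_eq_zero_of_complete (hW : MeasurableSet W)
    (hh : h =ᵐ[volume] W.indicator fun _ => (c : ℂ))
    (hcomplete : ∀ f : L2R, (∀ j k : ℤ, inner ℂ (modDil j k h) f = 0) → f = 0)
    {f : ℝ → ℂ} (hf : MemLp f 2 volume)
    (horth : ∀ j k : ℤ, ∫ y in W,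
      Complex.exp (((k * y : ℝ) : ℂ) * Complex.I) * f ((2 : ℝ) ^ j * y) = 0) :
    f =ᵐ[volume] 0 := by
  have h0 : hf.toLp f = 0 := hcomplete _ fun j k => by
    rw [inner_modDil_of_indicator hW hh]
    have h1 : ∀ᵐ y ∂(volume.restrict W), Complex.exp (((k * y : ℝ) : ℂ) * Complex.I) *
        hf.toLp f ((2 : ℝ) ^ j * y) =
          Complex.exp (((k * y : ℝ) : ℂ) * Complex.I) * f ((2 : ℝ) ^ j * y) := by
      filter_upwards [ae_restrict_of_ae
        (ae_mul_left (a := (2 : ℝ) ^ j) (by positivity) hf.coeFn_toLp)] with y hy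
      rw [hy]
    rw [integral_congr_ae h1, horth, mul_zero, mul_zero]
  exact (hf.coeFn_toLp.symm.trans (h0 ▸ Lp.coeFn_zero ℂ 2 volume))

/-- The inner product of the unmodulated functions at scales `j` and `0` is `2^{j/2} c²` times the
measure of `W ∩ 2^{-j} W`. -/
theorem dil_disjoint_of_orthonormal (hW : MeasurableSet W)
    (hh : h =ᵐ[volume] W.indicator fun _ => (c : ℂ)) (hc : c ≠ 0) (hfin : volume W ≠ ∞)
    (ho : Orthonormal ℂ (fun p : ℤ × ℤ => modDil p.1 p.2 h)) (j : ℤ) (hj : j ≠ 0) :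
    ∀ᵐ x : ℝ, x ∈ W → (2 : ℝ) ^ j * x ∉ W := by
  have h1 := ho.2 (i := (j, 0)) (j := (0, 0)) (by simp [hj])
  simp only [inner_modDil_of_indicator hW hh] at h1
  have hmeas : MeasurableSet ((fun y : ℝ => (2 : ℝ) ^ j * y) ⁻¹' W) :=
    (by fun_prop : Measurable _) hW
  have h2 : ∀ᵐ y ∂(volume.restrict W), Complex.exp ((((0 : ℤ) * y : ℝ) : ℂ) * Complex.I) *
      modDil 0 0 h ((2 : ℝ) ^ j * y) =
        ((fun y : ℝ => (2 : ℝ) ^ j * y) ⁻¹' W).indicator (fun _ => (c : ℂ)) y := by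
    filter_upwards [ae_restrict_of_ae
        (ae_mul_left (a := (2 : ℝ) ^ j) (by positivity) (coeFn_modDil 0 0 h)), ae_restrict_of_ae
        (ae_mul_left (a := (2 : ℝ) ^ j) (by positivity) hh)] with y h1 h2
    rw [h1]
    simp only [neg_zero, zpow_zero, one_mul]
    rw [h2]
    by_cases hy : (2 : ℝ) ^ j * y ∈ W <;> simp [hy]
  rw [integral_congr_ae h2, integral_indicator hmeas, setIntegral_const] at h1
  have h3 : ((((2 : ℝ) ^ ((j : ℝ) / 2) : ℝ) : ℂ)) ≠ 0 := Complex.ofReal_ne_zero.2 (by positivity)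
  have h4 : (volume.restrict W).real ((fun y : ℝ => (2 : ℝ) ^ j * y) ⁻¹' W) = 0 := by
    simpa only [mul_eq_zero, h3, hc, smul_eq_zero, Complex.ofReal_eq_zero, false_or, or_false]
      using h1
  have : IsFiniteMeasure (volume.restrict W) := ⟨by simpa using hfin.lt_top⟩
  rw [measureReal_eq_zero_iff, Measure.restrict_apply hmeas] at h4
  filter_upwards [measure_eq_zero_iff_ae_notMem.1 h4] with x hx hxW hxW'
  exact hx ⟨hxW', hxW⟩

theorem memLp_indicator_one {A : Set ℝ} (hA : MeasurableSet A) (hfin : volume A ≠ ∞) :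
    MemLp (A.indicator fun _ => (1 : ℂ)) 2 volume :=
  memLp_indicator_const 2 hA 1 (.inr hfin)

/-- The indicator of a bounded set of points with no dilate in `W` is orthogonal to the whole
family, hence vanishes a.e. -/
theorem dil_cover_of_complete (hW : MeasurableSet W)
    (hh : h =ᵐ[volume] W.indicator fun _ => (c : ℂ))
    (hcomplete : ∀ f : L2R, (∀ j k : ℤ, inner ℂ (modDil j k h) f = 0) → f = 0) :
    ∀ᵐ x : ℝ, ∃ j : ℤ, (2 : ℝ) ^ j * x ∈ W := by
  let N : Set ℝ := ⋂ j : ℤ, (fun x : ℝ => (2 : ℝ) ^ j * x) ⁻¹' Wᶜ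
  have hN : MeasurableSet N := .iInter fun j => (by fun_prop : Measurable _) hW.compl
  have key : ∀ n : ℕ, ∀ᵐ x : ℝ, x ∉ N ∩ Set.Icc (-n : ℝ) n := fun n => by
    have hA : MeasurableSet (N ∩ Set.Icc (-n : ℝ) n) := hN.inter measurableSet_Icc
    have hfin : volume (N ∩ Set.Icc (-n : ℝ) n) ≠ ∞ :=
      measure_ne_top_of_subset Set.inter_subset_right (by simp)
    refine (ae_eq_zero_of_complete hW hh hcomplete (memLp_indicator_one hA hfin)
      fun j k => ?_).mono fun x hx hxN => ?_
    swap
    · simp [Set.indicator_of_mem hxN] at hx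
    · rw [setIntegral_eq_zero_of_forall_eq_zero fun y hy => ?_]
      rw [Set.indicator_of_notMem, mul_zero]
      rintro ⟨h1, -⟩
      have h2 := Set.mem_iInter.1 h1 (-j)
      rw [Set.mem_preimage, ← mul_assoc, ← zpow_add₀ (by norm_num)] at h2
      simp [hy] at h2
  filter_upwards [ae_all_iff.2 key] with x hx
  by_contra! hno
  obtain ⟨n, hn⟩ := exists_nat_ge |x|
  exact hx n ⟨Set.mem_iInter.2 hno, abs_le.1 hn⟩

/-- Let `p = 2πk`. If `A` and `A + p` lie in `W`, then `χ_A - χ_{A+p}` is orthogonal to the family: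
at scale `0` because the exponentials have period `p`, at other scales because the dilates of `W`
are disjoint. When `A` and `A + p` are disjoint, completeness forces `A` to be null. -/
theorem trans_disjoint_of_complete (hW : MeasurableSet W)
    (hh : h =ᵐ[volume] W.indicator fun _ => (c : ℂ))
    (hcomplete : ∀ f : L2R, (∀ j k : ℤ, inner ℂ (modDil j k h) f = 0) → f = 0)
    (hd : ∀ j : ℤ, j ≠ 0 → ∀ᵐ x : ℝ, x ∈ W → (2 : ℝ) ^ j * x ∉ W) (k : ℤ) (hk : k ≠ 0) :
    ∀ᵐ x : ℝ, x ∈ W → x + k * (2 * Real.pi) ∉ W := by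
  set p : ℝ := k * (2 * Real.pi) with hp
  have hp0 : 0 < |p| := abs_pos.2 (by positivity)
  -- Cutting into half-open intervals of length `|p|` makes `A` finite in measure and disjoint from
  -- `A + p`.
  have key : ∀ m : ℤ, ∀ᵐ x : ℝ,
      x ∉ (W ∩ (fun x => x + p) ⁻¹' W) ∩ Set.Ico (m * |p|) ((m + 1) * |p|) := fun m => by
    set A : Set ℝ := (W ∩ (fun x => x + p) ⁻¹' W) ∩ Set.Ico (m * |p|) ((m + 1) * |p|) with hAdef
    have hA : MeasurableSet A :=
      (hW.inter ((by fun_prop : Measurable _) hW)).inter measurableSet_Ico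
    have hfin : volume A ≠ ∞ := measure_ne_top_of_subset Set.inter_subset_right (by simp)
    have hA' : MeasurableSet ((fun x => x - p) ⁻¹' A) := (by fun_prop : Measurable _) hA
    have hfin' : volume ((fun x => x - p) ⁻¹' A) ≠ ∞ := by
      rwa [(measurePreserving_sub_right volume p).measure_preimage hA.nullMeasurableSet]
    have hsub : A ⊆ W := fun x hx => hx.1.1
    have hsub' : (fun x => x - p) ⁻¹' A ⊆ W := fun x hx => by simpa using hx.1.2
    have hdisj : ∀ x ∈ A, x - p ∉ A := by
      intro x hx hx'
      have h1 := hx.2; have h2 := hx'.2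
      rcases abs_cases p with h3 | h3 <;> rw [h3.1] at h1 h2 <;> linarith [h1.1, h1.2, h2.1, h2.2]
    refine (ae_eq_zero_of_complete hW hh hcomplete
      ((memLp_indicator_one hA hfin).sub (memLp_indicator_one hA' hfin'))
      fun j l => ?_).mono fun x hx hxA => ?_
    swap
    · have hxA' : x ∉ (fun x => x - p) ⁻¹' A := hdisj x hxA
      rw [Pi.sub_apply, Set.indicator_of_mem hxA, Set.indicator_of_notMem hxA'] at hx
      simp at hx
    · by_cases hj : j = 0
      · have hint : ∀ B : Set ℝ, MeasurableSet B → volume B ≠ ∞ → Integrable (B.indicator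
            fun y : ℝ => Complex.exp (((l * y : ℝ) : ℂ) * Complex.I)) := fun B hB hBf => by
          rw [integrable_indicator_iff hB]
          exact Measure.integrableOn_of_bounded (M := 1) hBf
            (by fun_prop : Continuous _).aestronglyMeasurable
            (.of_forall fun y => by rw [Complex.norm_exp_ofReal_mul_I])
        have h2 : ∀ y : ℝ, W.indicator (fun y => Complex.exp (((l * y : ℝ) : ℂ) * Complex.I) *
            (A.indicator (fun _ => (1 : ℂ)) - ((fun x => x - p) ⁻¹' A).indicator fun _ => (1 : ℂ))
              ((2 : ℝ) ^ j * y)) y =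
            A.indicator (fun y => Complex.exp (((l * y : ℝ) : ℂ) * Complex.I)) y -
            ((fun x => x - p) ⁻¹' A).indicator
              (fun y => Complex.exp (((l * y : ℝ) : ℂ) * Complex.I)) y := by
          intro y
          subst hj
          by_cases hyA : y ∈ A
          · have := hdisj y hyA
            simp [hyA, hsub hyA, this]
          · by_cases hyA' : y - p ∈ A
            · have : y ∈ W := hsub' hyA'
              simp [hyA, hyA', this]
            · by_cases hyW : y ∈ W <;> simp [hyA, hyA', hyW]
        rw [← integral_indicator hW, integral_congr_ae (.of_forall h2),
          integral_sub (hint A hA hfin) (hint _ hA' hfin'), sub_eq_zero,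
          ← integral_sub_right_eq_self _ p]
        refine integral_congr_ae (.of_forall fun y => ?_)
        have h3 : Complex.exp (((l * (y - p) : ℝ) : ℂ) * Complex.I) =
            Complex.exp (((l * y : ℝ) : ℂ) * Complex.I) := by
          rw [Complex.exp_eq_exp_iff_exists_int]
          refine ⟨-(l * k), ?_⟩
          rw [hp]; push_cast; ring
        by_cases hyA' : y - p ∈ A <;>
          simp only [Set.indicator, hyA', Set.mem_preimage, if_true, if_false]
        exact h3
      · rw [integral_eq_zero_of_ae]
        filter_upwards [ae_restrict_mem hW, ae_restrict_of_ae (hd j hj)] with y hyW hy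
        have h1 : (2 : ℝ) ^ j * y ∉ A := fun hA => hy hyW (hsub hA)
        have h2 : (2 : ℝ) ^ j * y ∉ (fun x => x - p) ⁻¹' A := fun hA => hy hyW (hsub' hA)
        rw [Pi.sub_apply, Set.indicator_of_notMem h1, Set.indicator_of_notMem h2]
        simp
  filter_upwards [ae_all_iff.2 key] with x hx hxW hxW'
  refine hx ⌊x / |p|⌋ ⟨⟨hxW, hxW'⟩, ?_, ?_⟩
  · rw [← le_div_iff₀ hp0]; exact Int.floor_le _
  · rw [← div_lt_iff₀ hp0]; exact Int.lt_floor_add_one _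

theorem IsWaveletSet.isTile (hW : MeasurableSet W) (hwav : IsWaveletSet W) : IsTile W := by
  obtain ⟨-, w, hw, hww⟩ := hwav
  set c : ℝ := 1 / √(volume.real W) with hc
  have hh : plancherelIsometry w =ᵐ[volume] W.indicator fun _ => (c : ℂ) :=
    (coeFn_plancherelIsometry w).trans hww
  obtain ⟨ho, hcomplete⟩ := (isOrthonormalWavelet_iff w).1 hw
  -- `volume.real W` vanishes for null and for infinite measure alike; then `c = 1/0 = 0` and the
  -- wavelet would be zero.
  have hr : volume.real W ≠ 0 := by
    intro h0
    have h1 : plancherelIsometry w = 0 := by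
      refine Lp.ext (hh.trans (EventuallyEq.trans ?_ (Lp.coeFn_zero ℂ 2 volume).symm))
      refine .of_forall fun x => ?_
      simp [hc, h0]
    have h2 := ho.1 (0, 0)
    simp [h1] at h2
  have hc0 : c ≠ 0 := by
    have : 0 < volume.real W := lt_of_le_of_ne measureReal_nonneg (Ne.symm hr)
    positivity
  have hnt : volume W ≠ ∞ := fun h0 => hr (by simp [Measure.real, h0])
  have hd := dil_disjoint_of_orthonormal hW hh hc0 hnt ho
  refine ⟨hW, fun h0 => hr (by simp [Measure.real, h0]), hnt, hd,
    dil_cover_of_complete hW hh hcomplete, trans_disjoint_of_complete hW hh hcomplete hd,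
    fun k hk => ?_⟩
  have h1 := ho.2 (i := (0, k)) (j := (0, 0)) (by simp [hk])
  simp only [inner_modDil_modDil_same hW hh] at h1
  simpa [hc0] using h1

end IndicatorFamily

/-! ### Completeness of the measure algebra -/

section MeasuredSets

theorem exists_ge_mem_symmDiff_succ {α : Type*} {s : ℕ → Set α} {x : α} {n m : ℕ} (hnm : n ≤ m)
    (h : ¬ (x ∈ s n ↔ x ∈ s m)) : ∃ k ≥ n, x ∈ s k ∆ s (k + 1) := by
  contrapose! h
  induction m, hnm using Nat.le_induction with
  | base => rfl
  | succ m hm ih =>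
    have h1 := h m hm
    rw [Set.mem_symmDiff] at h1
    tauto

variable {α : Type*} [MeasurableSpace α]

/-- Measurable sets, with `μ (s ∆ t)` as distance, form a complete space. -/
theorem completeSpace_measuredSets (μ : Measure α) : CompleteSpace (MeasuredSets μ) := by
  refine EMetric.complete_of_convergent_controlled_sequences (fun n => (2⁻¹ : ℝ≥0∞) ^ n)
    (fun n => ENNReal.pow_pos (by simp) n) fun u hu => ?_
  -- The limsup of a sequence whose consecutive distances are below `2⁻ⁿ`. A point on which `u n`
  -- and `V` disagree must change membership at some later step, so the distance is at most the
  -- geometric tail.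
  let V : Set α := ⋂ n : ℕ, ⋃ k : ℕ, (u (n + k) : Set α)
  have hV : MeasurableSet V := .iInter fun n => .iUnion fun k => (u (n + k)).2
  let V' : MeasuredSets μ := ⟨V, hV⟩
  refine ⟨V', ?_⟩
  rw [tendsto_iff_edist_tendsto_0]
  have hsub : ∀ n, (u n : Set α) ∆ V ⊆ ⋃ k : ℕ, (u (n + k) : Set α) ∆ u (n + k + 1) := by
    intro n x hx
    have : ∃ m ≥ n, ¬ (x ∈ (u n : Set α) ↔ x ∈ (u m : Set α)) := by
      by_contra! hno
      rcases hx with ⟨h1, h2⟩ | ⟨h1, h2⟩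
      · refine h2 (Set.mem_iInter.2 fun i => Set.mem_iUnion.2 ⟨n, ?_⟩)
        exact (hno (i + n) (by omega)).1 h1
      · obtain ⟨k, hk⟩ := Set.mem_iUnion.1 (Set.mem_iInter.1 h1 n)
        exact h2 ((hno (n + k) (by omega)).2 hk)
    obtain ⟨m, hnm, hm⟩ := this
    obtain ⟨k, hk, hxk⟩ := exists_ge_mem_symmDiff_succ (s := fun i => (u i : Set α)) hnm hm
    refine Set.mem_iUnion.2 ⟨k - n, ?_⟩
    rwa [Nat.add_sub_cancel' hk]
  have hle : ∀ n, edist (u n) V' ≤ (2⁻¹ : ℝ≥0∞) ^ n * 2 := by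
    intro n
    calc edist (u n) V' = μ ((u n : Set α) ∆ V) := rfl
      _ ≤ ∑' k : ℕ, μ ((u (n + k) : Set α) ∆ u (n + k + 1)) :=
        (measure_mono (hsub n)).trans (measure_iUnion_le _)
      _ ≤ ∑' k : ℕ, (2⁻¹ : ℝ≥0∞) ^ (n + k) :=
        ENNReal.tsum_le_tsum fun k => (hu (n + k) _ _ le_rfl (Nat.le_succ _)).le
      _ = (2⁻¹ : ℝ≥0∞) ^ n * 2 := by
        simp_rw [pow_add]
        rw [ENNReal.tsum_mul_left, ENNReal.tsum_geometric, ENNReal.one_sub_inv_two, inv_inv]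
  refine tendsto_of_tendsto_of_tendsto_of_le_of_le tendsto_const_nhds ?_ (fun _ => zero_le) hle
  have := ENNReal.Tendsto.mul_const (b := 2)
    (ENNReal.tendsto_pow_atTop_nhds_zero_of_lt_one (r := 2⁻¹) (by simp)) (.inr (by simp))
  simpa using this

end MeasuredSets

/-! ### The dilation invariant measure and its fundamental domain -/

/-- The dilation invariant measure `dx / |x|`. -/
def dilMeasure : Measure ℝ := volume.withDensity fun x => ENNReal.ofReal (1 / |x|)

theorem dilMeasure_apply (s : Set ℝ) : dilMeasure s = ∫⁻ x in s, ENNReal.ofReal (1 / |x|) :=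
  withDensity_apply' _ _

theorem measurable_density : Measurable fun x : ℝ => ENNReal.ofReal (1 / |x|) := by fun_prop

theorem dilMeasure_ac : dilMeasure ≪ volume := withDensity_absolutelyContinuous _ _

theorem ac_dilMeasure : volume ≪ dilMeasure := by
  refine withDensity_absolutelyContinuous' measurable_density.aemeasurable ?_
  filter_upwards [Measure.ae_ne volume (0 : ℝ)] with x hx
  have : 0 < 1 / |x| := by positivity
  simpa using hx

theorem dilMeasure_preimage_mul {a : ℝ} (ha : a ≠ 0) {s : Set ℝ} (hs : MeasurableSet s) :
    dilMeasure ((fun x => a * x) ⁻¹' s) = dilMeasure s := by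
  have hm : MeasurableSet ((fun x => a * x) ⁻¹' s) := (by fun_prop : Measurable _) hs
  let F : ℝ → ℝ≥0∞ := s.indicator fun x => ENNReal.ofReal (1 / |x|)
  have hF : Measurable F := measurable_density.indicator hs
  rw [dilMeasure_apply, dilMeasure_apply, ← lintegral_indicator hm, ← lintegral_indicator hs]
  have h1 : ∀ x, ((fun x => a * x) ⁻¹' s).indicator (fun x => ENNReal.ofReal (1 / |x|)) x =
      ENNReal.ofReal |a| * F (a * x) := by
    intro x
    by_cases hx : a * x ∈ s
    · rw [Set.indicator_of_mem (show x ∈ (fun x => a * x) ⁻¹' s from hx)]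
      simp only [F, Set.indicator_of_mem hx]
      rw [← ENNReal.ofReal_mul (abs_nonneg _), abs_mul]
      congr 1
      have := abs_pos.2 ha
      by_cases hx0 : x = 0
      · simp [hx0]
      · have := abs_pos.2 hx0
        field_simp
    · rw [Set.indicator_of_notMem (show x ∉ (fun x => a * x) ⁻¹' s from hx)]
      simp [F, Set.indicator_of_notMem hx]
  simp_rw [h1]
  rw [lintegral_const_mul _ (by fun_prop), ← lintegral_map (f := F) hF (by fun_prop),
    Real.map_volume_mul_left ha, lintegral_smul_measure, smul_eq_mul, ← mul_assoc,
    ← ENNReal.ofReal_mul (abs_nonneg _), ← abs_mul, mul_inv_cancel₀ ha]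
  simp [F]

/-- A fundamental domain for the dyadic dilations. -/
def annulus : Set ℝ := {x | 1 ≤ |x| ∧ |x| < 2}

theorem measurableSet_annulus : MeasurableSet annulus :=
  (measurableSet_le measurable_const measurable_norm).inter
    (measurableSet_lt measurable_norm measurable_const)

theorem dilMeasure_annulus_ne_top : dilMeasure annulus ≠ ∞ := by
  rw [dilMeasure_apply]
  refine ne_top_of_le_ne_top ?_
    (setLIntegral_mono measurable_const (g := fun _ => 1) fun x hx => ?_)
  · rw [setLIntegral_const, one_mul]
    have hsub : annulus ⊆ Set.Icc (-2) 2 := fun x hx => abs_le.1 hx.2.le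
    exact measure_ne_top_of_subset hsub (by simp)
  · rw [ENNReal.ofReal_le_one, div_le_one (by linarith [hx.1])]
    exact hx.1

theorem exists_zpow_mul_mem_annulus {x : ℝ} (hx : x ≠ 0) : ∃ j : ℤ, (2 : ℝ) ^ j * x ∈ annulus := by
  obtain ⟨n, h1, h2⟩ := exists_mem_Ico_zpow (abs_pos.2 hx) (one_lt_two (α := ℝ))
  have hp : (0 : ℝ) < 2 ^ n := by positivity
  refine ⟨-n, ?_⟩
  change 1 ≤ |_| ∧ |_| < (2 : ℝ)
  rw [abs_mul, abs_of_pos (by positivity), zpow_neg,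
    ← div_eq_inv_mul, le_div_iff₀ hp, div_lt_iff₀ hp, one_mul]
  rw [zpow_add_one₀ (by norm_num)] at h2
  exact ⟨h1, by linarith⟩

theorem zpow_mul_mem_annulus_unique {x : ℝ} {i j : ℤ} (hi : (2 : ℝ) ^ i * x ∈ annulus)
    (hj : (2 : ℝ) ^ j * x ∈ annulus) : i = j := by
  have key : ∀ {i j : ℤ}, (2 : ℝ) ^ i * x ∈ annulus → (2 : ℝ) ^ j * x ∈ annulus → j ≤ i := by
    intro i j hi hj
    by_contra! hlt
    obtain ⟨h1, -⟩ := hi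
    obtain ⟨-, h2⟩ := hj
    rw [abs_mul, abs_of_pos (by positivity)] at h1 h2
    have h3 : (2 : ℝ) ^ (i + 1) ≤ 2 ^ j := zpow_le_zpow_right₀ one_le_two hlt
    rw [zpow_add_one₀ (by norm_num)] at h3
    nlinarith [abs_nonneg x]
  exact le_antisymm (key hj hi) (key hi hj)

theorem measurableSet_preimage_mul (a : ℝ) {s : Set ℝ} (hs : MeasurableSet s) :
    MeasurableSet ((fun x => a * x) ⁻¹' s) := (by fun_prop : Measurable _) hs

/-- The dilated annuli partition the line minus the origin; invariance carries each piece of `s`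
back to the annulus. The sum thus counts points of the annulus by how many of their dilates lie in
`s`. -/
theorem dilMeasure_eq_tsum {s : Set ℝ} (hs : MeasurableSet s) :
    dilMeasure s = ∑' j : ℤ, dilMeasure (annulus ∩ (fun x => (2 : ℝ) ^ j * x) ⁻¹' s) := by
  have h1 : s =ᵐ[dilMeasure] ⋃ j : ℤ, (fun x => (2 : ℝ) ^ (-j) * x) ⁻¹' annulus ∩ s := by
    refine dilMeasure_ac.ae_le ?_
    filter_upwards [Measure.ae_ne volume (0 : ℝ)] with x hx
    refine propext ⟨fun hxs => ?_, fun hxU => ?_⟩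
    · obtain ⟨j, hj⟩ := exists_zpow_mul_mem_annulus hx
      exact Set.mem_iUnion.2 ⟨-j, by simpa using hj, hxs⟩
    · obtain ⟨j, hj⟩ := Set.mem_iUnion.1 hxU
      exact hj.2
  rw [measure_congr h1, measure_iUnion]
  · refine tsum_congr fun j => ?_
    rw [← dilMeasure_preimage_mul (a := (2 : ℝ) ^ j) (by positivity)
      ((measurableSet_preimage_mul _ measurableSet_annulus).inter hs), Set.preimage_inter]
    congr 2
    ext x
    simp only [Set.mem_preimage]
    rw [← mul_assoc, ← zpow_add₀ (by norm_num), neg_add_cancel, zpow_zero, one_mul]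
  · intro i j hij
    refine Set.disjoint_left.2 fun x hi hj => hij ?_
    exact neg_injective (zpow_mul_mem_annulus_unique hi.1 hj.1)
  · exact fun j => (measurableSet_preimage_mul _ measurableSet_annulus).inter hs

/-- The pieces of `W` brought back to the annulus are a.e. disjoint, so their total weight is at
most that of the annulus. -/
theorem IsTile.dilMeasure_ne_top {W : Set ℝ} (hW : IsTile W) : dilMeasure W ≠ ∞ := by
  rw [dilMeasure_eq_tsum hW.measurableSet, ← measure_iUnion₀]
  · exact measure_ne_top_of_subset (Set.iUnion_subset fun j => Set.inter_subset_left)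
      dilMeasure_annulus_ne_top
  · intro i j hij
    refine dilMeasure_ac ?_
    rw [measure_eq_zero_iff_ae_notMem]
    filter_upwards [ae_mul_left (a := (2 : ℝ) ^ i) (by positivity)
      (hW.dil_disjoint (j - i) (sub_ne_zero.2 hij.symm))] with x hx hxm
    refine hx hxm.1.2 ?_
    rw [← mul_assoc, ← zpow_add₀ (by norm_num), sub_add_cancel]
    exact hxm.2.2
  · exact fun j => (measurableSet_annulus.inter
      (measurableSet_preimage_mul _ hW.measurableSet)).nullMeasurableSet

/-! ### Limits of tiles are tiles -/

section Limit

variable {W : ℕ → Set ℝ} {V : Set ℝ}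

/-- A point of `V ∩ T⁻¹ V` outside the null set `W n ∩ T⁻¹ (W n)` lies in `W n ∆ V` or is sent there
by `T`. This serves both the dilations and the translations. -/
theorem ae_disjoint_of_tendsto_symmDiff {T : ℝ → ℝ} {C : ℝ≥0∞} (hC : C ≠ ∞)
    (hT : ∀ s, volume (T ⁻¹' s) ≤ C * volume s)
    (hlim : Tendsto (fun n => volume (W n ∆ V)) atTop (𝓝 0))
    (hd : ∀ n, ∀ᵐ x, x ∈ W n → T x ∉ W n) : ∀ᵐ x, x ∈ V → T x ∉ V := by
  have hle : ∀ n, volume (V ∩ T ⁻¹' V) ≤ volume (W n ∆ V) + C * volume (W n ∆ V) := by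
    intro n
    have hz : volume (W n ∩ T ⁻¹' W n) = 0 := by
      rw [measure_eq_zero_iff_ae_notMem]
      filter_upwards [hd n] with x hx hx'
      exact hx hx'.1 hx'.2
    have hsub : V ∩ T ⁻¹' V ⊆ (W n ∩ T ⁻¹' W n) ∪ (W n ∆ V ∪ T ⁻¹' (W n ∆ V)) := by
      rintro x ⟨h1, h2⟩
      by_cases h3 : x ∈ W n
      · by_cases h4 : T x ∈ W n
        · exact .inl ⟨h3, h4⟩
        · exact .inr (.inr (.inr ⟨h2, h4⟩))
      · exact .inr (.inl (.inr ⟨h1, h3⟩))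
    calc volume (V ∩ T ⁻¹' V)
        ≤ volume (W n ∩ T ⁻¹' W n) + (volume (W n ∆ V) + volume (T ⁻¹' (W n ∆ V))) :=
          (measure_mono hsub).trans ((measure_union_le _ _).trans
            (add_le_add le_rfl (measure_union_le _ _)))
      _ ≤ volume (W n ∆ V) + C * volume (W n ∆ V) := by
        rw [hz, zero_add]
        exact add_le_add le_rfl (hT _)
  have hlim' : Tendsto (fun n => volume (W n ∆ V) + C * volume (W n ∆ V)) atTop (𝓝 0) := by
    simpa using hlim.add (ENNReal.Tendsto.const_mul hlim (.inr hC))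
  have hzero := le_antisymm (ge_of_tendsto' hlim' hle) zero_le
  filter_upwards [measure_eq_zero_iff_ae_notMem.1 hzero] with x hx h1 h2
  exact hx ⟨h1, h2⟩

/-- As `|e| ≤ 1`, replacing `W n` by `V` changes the integral by at most the measure of `W n ∆ V`.
-/
theorem setIntegral_eq_zero_of_tendsto_symmDiff (hW : ∀ n, MeasurableSet (W n))
    (hV : MeasurableSet V) (hWfin : ∀ n, volume (W n) ≠ ∞) (hVfin : volume V ≠ ∞)
    (hlim : Tendsto (fun n => volume (W n ∆ V)) atTop (𝓝 0)) {e : ℝ → ℂ} (he : Continuous e)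
    (hn : ∀ x, ‖e x‖ ≤ 1) (hz : ∀ n, ∫ x in W n, e x = 0) : ∫ x in V, e x = 0 := by
  have hint : ∀ {s : Set ℝ}, MeasurableSet s → volume s ≠ ∞ → Integrable (s.indicator e) :=
    fun hs hfin => (integrable_indicator_iff hs).2
      (Measure.integrableOn_of_bounded (M := 1) hfin he.aestronglyMeasurable (.of_forall hn))
  have hfin : ∀ n, volume (W n ∆ V) ≠ ∞ := fun n =>
    ne_top_of_le_ne_top (ENNReal.add_ne_top.2 ⟨hWfin n, hVfin⟩)
      ((measure_mono Set.symmDiff_subset_union).trans (measure_union_le _ _))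
  have hle : ∀ n, ‖∫ x in V, e x‖ ≤ volume.real (W n ∆ V) := by
    intro n
    have hm : MeasurableSet (W n ∆ V) := (hW n).symmDiff hV
    calc ‖∫ x in V, e x‖ = ‖∫ x, (W n).indicator e x - V.indicator e x‖ := by
          rw [integral_sub (hint (hW n) (hWfin n)) (hint hV hVfin), integral_indicator (hW n),
            integral_indicator hV, hz n, zero_sub, norm_neg]
      _ ≤ ∫ x, (W n ∆ V).indicator (fun _ => (1 : ℝ)) x := by
          refine norm_integral_le_of_norm_le ((integrable_indicator_iff hm).2
            (integrableOn_const (hfin n))) (.of_forall fun x => ?_)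
          by_cases h1 : x ∈ W n <;> by_cases h2 : x ∈ V <;>
            simp [Set.indicator, Set.mem_symmDiff, h1, h2, hn x]
      _ = volume.real (W n ∆ V) := by rw [integral_indicator hm]; simp
  have hlim' : Tendsto (fun n => volume.real (W n ∆ V)) atTop (𝓝 0) := by
    simpa [Measure.real, Function.comp_def] using (ENNReal.tendsto_toReal ENNReal.zero_ne_top).comp hlim
  exact norm_le_zero_iff.1 (ge_of_tendsto' hlim' hle)

/-- The set `N` of points with no dilate in `V` is dilation invariant. Almost every point of
`annulus ∩ N` has a dilate in `W n ∩ N`, so invariance of the measure bounds its weight by that of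
`W n ∩ N`, which is contained in `W n ∆ V`. Lebesgue measure alone would not do, since it hardly
sees what happens near the origin. -/
theorem dil_cover_of_tendsto_symmDiff (hW : ∀ n, MeasurableSet (W n)) (hV : MeasurableSet V)
    (hlim : Tendsto (fun n => dilMeasure (W n ∆ V)) atTop (𝓝 0))
    (hcov : ∀ n, ∀ᵐ x : ℝ, ∃ j : ℤ, (2 : ℝ) ^ j * x ∈ W n) :
    ∀ᵐ x : ℝ, ∃ j : ℤ, (2 : ℝ) ^ j * x ∈ V := by
  let N : Set ℝ := ⋂ j : ℤ, (fun x : ℝ => (2 : ℝ) ^ j * x) ⁻¹' Vᶜ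
  have hN : MeasurableSet N := .iInter fun j => measurableSet_preimage_mul _ hV.compl
  have hinv : ∀ i : ℤ, ∀ x ∈ N, (2 : ℝ) ^ i * x ∈ N := by
    intro i x hx
    refine Set.mem_iInter.2 fun j => ?_
    rw [Set.mem_preimage, ← mul_assoc, ← zpow_add₀ (by norm_num)]
    exact Set.mem_iInter.1 hx (j + i)
  have hNV : ∀ x ∈ N, x ∉ V := fun x hx => by simpa using Set.mem_iInter.1 hx 0
  have hle : ∀ n, dilMeasure (annulus ∩ N) ≤ dilMeasure (W n ∆ V) := by
    intro n
    calc dilMeasure (annulus ∩ N)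
        ≤ dilMeasure (⋃ j : ℤ, annulus ∩ (fun x => (2 : ℝ) ^ j * x) ⁻¹' (W n ∩ N)) := by
          refine measure_mono_ae (dilMeasure_ac.ae_le ?_)
          filter_upwards [hcov n] with x hx hxN
          obtain ⟨j, hj⟩ := hx
          exact Set.mem_iUnion.2 ⟨j, hxN.1, hj, hinv j x hxN.2⟩
      _ ≤ ∑' j : ℤ, dilMeasure (annulus ∩ (fun x => (2 : ℝ) ^ j * x) ⁻¹' (W n ∩ N)) :=
          measure_iUnion_le _
      _ = dilMeasure (W n ∩ N) := (dilMeasure_eq_tsum ((hW n).inter hN)).symm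
      _ ≤ dilMeasure (W n ∆ V) := measure_mono fun x hx => .inl ⟨hx.1, hNV x hx.2⟩
  have hzero : dilMeasure (annulus ∩ N) = 0 := le_antisymm (ge_of_tendsto' hlim hle) zero_le
  -- By invariance, each term of the decomposition of `N` is contained in `annulus ∩ N`.
  have hNzero : dilMeasure N = 0 := by
    rw [dilMeasure_eq_tsum hN, ENNReal.tsum_eq_zero]
    intro j
    have hsub : annulus ∩ (fun x => (2 : ℝ) ^ j * x) ⁻¹' N ⊆ annulus ∩ N := fun x hx => by
      have := hinv (-j) _ hx.2
      rw [← mul_assoc, ← zpow_add₀ (by norm_num), neg_add_cancel, zpow_zero, one_mul] at this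
      exact ⟨hx.1, this⟩
    exact measure_mono_null hsub hzero
  filter_upwards [measure_eq_zero_iff_ae_notMem.1 (ac_dilMeasure hNzero)] with x hx
  by_contra! hno
  exact hx (Set.mem_iInter.2 hno)

theorem isTile_of_tendsto_symmDiff (hW : ∀ n, IsTile (W n)) (hV : MeasurableSet V)
    (hlim : Tendsto (fun n => volume (W n ∆ V)) atTop (𝓝 0))
    (hlim' : Tendsto (fun n => dilMeasure (W n ∆ V)) atTop (𝓝 0)) : IsTile V := by
  have hcov : ∀ᵐ x : ℝ, ∃ j : ℤ, (2 : ℝ) ^ j * x ∈ V :=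
    dil_cover_of_tendsto_symmDiff (fun n => (hW n).measurableSet) hV hlim'
      fun n => (hW n).dil_cover
  have hfin : volume V ≠ ∞ := by
    obtain ⟨n, hn⟩ := (hlim.eventually_lt_const (zero_lt_one (α := ℝ≥0∞))).exists
    have hsub : V ⊆ W n ∪ W n ∆ V := fun x hx => by
      by_cases h : x ∈ W n
      · exact .inl h
      · exact .inr (.inr ⟨hx, h⟩)
    exact ne_top_of_le_ne_top
      (ENNReal.add_ne_top.2 ⟨(hW n).volume_ne_top, (hn.trans ENNReal.one_lt_top).ne⟩)
      ((measure_mono hsub).trans (measure_union_le _ _))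
  refine ⟨hV, fun h0 => ?_, hfin, fun j hj => ?_, hcov, fun k hk => ?_, fun k hk => ?_⟩
  -- Countably many dilates of a null set cannot cover almost every point.
  · have h1 : ∀ᵐ x : ℝ, ∀ j : ℤ, (2 : ℝ) ^ j * x ∉ V := ae_all_iff.2 fun j =>
      ae_mul_left (by positivity) (measure_eq_zero_iff_ae_notMem.1 h0)
    obtain ⟨x, hx, j, hj⟩ := (h1.and hcov).exists
    exact hx j hj
  · refine ae_disjoint_of_tendsto_symmDiff (C := ENNReal.ofReal |((2 : ℝ) ^ j)⁻¹|) (by simp)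
      (fun s => ?_) hlim fun n => (hW n).dil_disjoint j hj
    exact (Real.volume_preimage_mul_left (by positivity) s).le
  · refine ae_disjoint_of_tendsto_symmDiff (C := 1) (by simp)
      (fun s => ?_) hlim fun n => (hW n).trans_disjoint k hk
    rw [measure_preimage_add_right, one_mul]
  · exact setIntegral_eq_zero_of_tendsto_symmDiff (fun n => (hW n).measurableSet) hV
      (fun n => (hW n).volume_ne_top) hfin hlim (by fun_prop)
      (fun x => (Complex.norm_exp_ofReal_mul_I _).le) fun n => (hW n).exp_orthogonal k hk

end Limit

/-! ### The metric and its completeness -/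

theorem waveletDist_eq (W₁ W₂ : Set ℝ) : waveletDist W₁ W₂ =
    volume (W₁ ∆ W₂) ^ (1 / 2 : ℝ) + dilMeasure (W₁ ∆ W₂) ^ (1 / 2 : ℝ) := by
  rw [waveletDist, dilMeasure_apply]

theorem waveletDist_comm (W₁ W₂ : Set ℝ) : waveletDist W₁ W₂ = waveletDist W₂ W₁ := by
  rw [waveletDist, waveletDist, symmDiff_comm]

theorem waveletDist_eq_zero_iff (W₁ W₂ : Set ℝ) :
    waveletDist W₁ W₂ = 0 ↔ W₁ =ᵐ[volume] W₂ := by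
  rw [waveletDist_eq, ← measure_symmDiff_eq_zero_iff, add_eq_zero,
    ENNReal.rpow_eq_zero_iff_of_pos (by norm_num), ENNReal.rpow_eq_zero_iff_of_pos (by norm_num)]
  exact ⟨fun h => h.1, fun h => ⟨h, dilMeasure_ac h⟩⟩

/-- For each of the two measures: the triangle inequality for `μ (A ∆ B)`, then subadditivity of the
square root. -/
theorem waveletDist_triangle (W₁ W₂ W₃ : Set ℝ) :
    waveletDist W₁ W₃ ≤ waveletDist W₁ W₂ + waveletDist W₂ W₃ := by
  have key : ∀ μ : Measure ℝ, μ (W₁ ∆ W₃) ^ (1 / 2 : ℝ) ≤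
      μ (W₁ ∆ W₂) ^ (1 / 2 : ℝ) + μ (W₂ ∆ W₃) ^ (1 / 2 : ℝ) := fun μ =>
    (ENNReal.rpow_le_rpow (measure_symmDiff_le _ _ _) (by norm_num)).trans
      (ENNReal.rpow_add_le_add_rpow _ _ (by norm_num) (by norm_num))
  simp only [waveletDist_eq]
  exact (add_le_add (key _) (key _)).trans_eq (add_add_add_comm _ _ _ _)

theorem waveletDist_congr {W₁ W₂ V₁ V₂ : Set ℝ} (h₁ : W₁ =ᵐ[volume] V₁)
    (h₂ : W₂ =ᵐ[volume] V₂) : waveletDist W₁ W₂ = waveletDist V₁ V₂ := by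
  have h : (W₁ ∆ W₂ : Set ℝ) =ᵐ[volume] (V₁ ∆ V₂ : Set ℝ) := h₁.symmDiff h₂
  rw [waveletDist_eq, waveletDist_eq, measure_congr h, measure_congr (dilMeasure_ac.ae_le h)]

/-- A wavelet set is only null measurable; its measurable hull differs from it by a null set. -/
theorem IsWaveletSet.exists_isTile {W : Set ℝ} (hW : IsWaveletSet W) :
    ∃ E, IsTile E ∧ W =ᵐ[volume] E := by
  have h := hW.1.toMeasurable_ae_eq.symm
  exact ⟨_, (hW.congr h).isTile (measurableSet_toMeasurable _ _), h⟩

theorem IsTile.waveletDist_lt_top {W₁ W₂ : Set ℝ} (h₁ : IsTile W₁) (h₂ : IsTile W₂) :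
    waveletDist W₁ W₂ < ∞ := by
  have key : ∀ μ : Measure ℝ, μ W₁ ≠ ∞ → μ W₂ ≠ ∞ → μ (W₁ ∆ W₂) ^ (1 / 2 : ℝ) < ∞ :=
    fun μ h h' => ENNReal.rpow_lt_top_of_nonneg (by norm_num)
      (ne_top_of_le_ne_top (ENNReal.add_ne_top.2 ⟨h, h'⟩)
        ((measure_mono Set.symmDiff_subset_union).trans (measure_union_le _ _)))
  rw [waveletDist_eq]
  exact ENNReal.add_lt_top.2 ⟨key _ h₁.volume_ne_top h₂.volume_ne_top,
    key _ h₁.dilMeasure_ne_top h₂.dilMeasure_ne_top⟩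

theorem lt_of_rpow_half_lt {x δ : ℝ≥0∞} (h : x ^ (1 / 2 : ℝ) < δ) (hδ : δ ≤ 1) : x < δ := by
  refine lt_of_le_of_lt ?_ h
  have h1 : x ^ (1 / 2 : ℝ) ≤ 1 := h.le.trans hδ
  calc x = x ^ (1 / 2 : ℝ) * x ^ (1 / 2 : ℝ) := by
        rw [← ENNReal.rpow_add_of_nonneg _ _ (by norm_num) (by norm_num)]; norm_num
    _ ≤ x ^ (1 / 2 : ℝ) := mul_le_of_le_one_right zero_le h1

theorem exists_isTile_tendsto_waveletDist {E : ℕ → Set ℝ} (hE : ∀ n, IsTile (E n))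
    (hcauchy : ∀ ε : ℝ≥0∞, 0 < ε → ∃ N : ℕ, ∀ m ≥ N, ∀ n ≥ N, waveletDist (E m) (E n) < ε) :
    ∃ V, IsTile V ∧ Tendsto (fun n => waveletDist (E n) V) atTop (𝓝 0) := by
  -- One measure that controls both terms of `d`, so that a single limit set serves for both.
  let ρ : Measure ℝ := volume + dilMeasure
  have := completeSpace_measuredSets ρ
  let u : ℕ → MeasuredSets ρ := fun n => ⟨E n, (hE n).measurableSet⟩
  have hu : CauchySeq u := by
    rw [EMetric.cauchySeq_iff]
    intro ε hε
    -- The bound `1` makes each measure at most its square root; `ε / 2` is the share of each of the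
    -- two measures.
    obtain ⟨N, hN⟩ := hcauchy (min 1 (ε / 2)) (lt_min one_pos (ENNReal.half_pos hε.ne'))
    refine ⟨N, fun m hm n hn => ?_⟩
    have h1 := hN m hm n hn
    rw [waveletDist_eq] at h1
    have h2 := lt_of_rpow_half_lt (lt_of_le_of_lt le_self_add h1) (min_le_left _ _)
    have h3 := lt_of_rpow_half_lt (lt_of_le_of_lt le_add_self h1) (min_le_left _ _)
    calc edist (u m) (u n) = volume (E m ∆ E n) + dilMeasure (E m ∆ E n) := rfl
      _ < ε / 2 + ε / 2 :=
        ENNReal.add_lt_add (h2.trans_le (min_le_right _ _)) (h3.trans_le (min_le_right _ _))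
      _ = ε := ENNReal.add_halves ε
  obtain ⟨V', hV'⟩ := cauchySeq_tendsto_of_complete hu
  obtain ⟨V, hV⟩ : ∃ V : Set ℝ, V = V' := ⟨_, rfl⟩
  have hVm : MeasurableSet V := hV ▸ V'.2
  rw [tendsto_iff_edist_tendsto_0] at hV'
  have hsum : Tendsto (fun n => volume (E n ∆ V) + dilMeasure (E n ∆ V)) atTop (𝓝 0) := by
    rw [hV]; exact hV'
  have hvol : Tendsto (fun n => volume (E n ∆ V)) atTop (𝓝 0) :=
    tendsto_of_tendsto_of_tendsto_of_le_of_le tendsto_const_nhds hsum (fun _ => zero_le)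
      fun _ => le_self_add
  have hdil : Tendsto (fun n => dilMeasure (E n ∆ V)) atTop (𝓝 0) :=
    tendsto_of_tendsto_of_tendsto_of_le_of_le tendsto_const_nhds hsum (fun _ => zero_le)
      fun _ => le_add_self
  refine ⟨V, isTile_of_tendsto_symmDiff hE hVm hvol hdil, ?_⟩
  have hc := (ENNReal.continuous_rpow_const (y := 1 / 2)).tendsto 0
  rw [ENNReal.zero_rpow_of_pos (by norm_num)] at hc
  simpa only [waveletDist_eq, add_zero, Function.comp_def] using
    (hc.comp hvol).add (hc.comp hdil)

end Wavelet

end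

theorem theorem3p8 :
    -- `d` is a finite metric on the class of wavelet sets modulo null sets
    (∀ W₁ W₂ : Set ℝ, Wavelet.IsWaveletSet W₁ → Wavelet.IsWaveletSet W₂ →
      Wavelet.waveletDist W₁ W₂ < ∞ ∧
      Wavelet.waveletDist W₁ W₂ = Wavelet.waveletDist W₂ W₁ ∧
      (Wavelet.waveletDist W₁ W₂ = 0 ↔ W₁ =ᵐ[volume] W₂)) ∧
    (∀ W₁ W₂ W₃ : Set ℝ, Wavelet.IsWaveletSet W₁ → Wavelet.IsWaveletSet W₂ →
      Wavelet.IsWaveletSet W₃ →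
      Wavelet.waveletDist W₁ W₃ ≤ Wavelet.waveletDist W₁ W₂ + Wavelet.waveletDist W₂ W₃) ∧
    -- every `d`-Cauchy sequence of wavelet sets converges in `d` to a wavelet set
    (∀ W : ℕ → Set ℝ, (∀ n, Wavelet.IsWaveletSet (W n)) →
      (∀ ε : ℝ≥0∞, 0 < ε → ∃ N : ℕ, ∀ m ≥ N, ∀ n ≥ N, Wavelet.waveletDist (W m) (W n) < ε) →
      ∃ V : Set ℝ, Wavelet.IsWaveletSet V ∧
        Tendsto (fun n => Wavelet.waveletDist (W n) V) atTop (𝓝 0)) := by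
  refine ⟨fun W₁ W₂ h₁ h₂ => ⟨?_, Wavelet.waveletDist_comm _ _,
    Wavelet.waveletDist_eq_zero_iff _ _⟩,
    fun W₁ W₂ W₃ _ _ _ => Wavelet.waveletDist_triangle _ _ _, fun W hW hcauchy => ?_⟩
  · obtain ⟨E₁, hE₁, h₁⟩ := h₁.exists_isTile
    obtain ⟨E₂, hE₂, h₂⟩ := h₂.exists_isTile
    rw [Wavelet.waveletDist_congr h₁ h₂]
    exact hE₁.waveletDist_lt_top hE₂
  · choose E hE hWE using fun n => (hW n).exists_isTile
    obtain ⟨V, hV, hlim⟩ := Wavelet.exists_isTile_tendsto_waveletDist hE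
      (by simpa only [Wavelet.waveletDist_congr (hWE _) (hWE _)] using hcauchy)
    refine ⟨V, hV.isWaveletSet, hlim.congr fun n => ?_⟩
    exact (Wavelet.waveletDist_congr (hWE n) .rfl).symm
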